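/- Let $\mathbb T$ be the unit circle with normalized Lebesgue measure $m$, and regard $H^2$ and $H^\infty$ as the closed subspaces of $L^2(\mathbb T)$ and $L^\infty(\mathbb T)$ formed by the boundary functions, i.e. by the functions whose Fourier coefficients of negative index vanish. A function $u\in H^\infty$ is inner if $|u|=1$ a.e. on $\mathbb T$. A function $p\in H^2$ is outer if its holomorphic extension to the open unit disk $\mathbb D$ is $z\mapsto c\exp\left(\int_{\mathbb T}\frac{\zeta+z}{\zeta-z}\log|f(\zeta)|\,dm(\zeta)\right)$ for some function $f$ on $\mathbb T$ with $\log|f|\in L^1(\mathbb T)$ and some constant $c$ with $|c|=1$. Let $E_1$ be a closed subspace of $H^2$, and let $E_2\subseteq H^2$ be a simply invariant closed subspace (that is, $zE_2\subsetneq E_2$), written as $E_2=\Theta_2H^2$ with $\Theta_2$ inner. For $g\in L^\infty(\mathbb T)$ let $T_g^{E_1,E_2}\colon E_1\to E_2$, $T_g^{E_1,E_2}f=P_{E_2}(gf)$, where $P_{E_2}$ is the orthogonal projection of $L^2(\mathbb T)$ onto $E_2$; thus $\ker T_g^{E_1,E_2}=\{f\in E_1: gf\perp E_2\}$. For $k\in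 E_1$, let $K_{\min}^{E_1,E_2}(k)$ denote the smallest (with respect to inclusion) of all the subspaces $\ker T_g^{E_1,E_2}$, $g\in L^\infty(\mathbb T)$, that contain $k$. **Proposition.** Let $k\in E_1$ have an inner--outer factorization $k=\theta p$ with $\theta$ inner and $p\in H^2$ outer. Then $\frac{\Theta_2\,\overline{\theta z p}}{p}\in L^\infty(\mathbb T)$, the minimal kernel $K_{\min}^{E_1,E_2}(k)$ exists, and $$K_{\min}^{E_1,E_2}(k)=\ker T^{E_1,E_2}_{\frac{\Theta_2\,\overline{\theta z p}}{p}} .$$ -/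

import Mathlib

open MeasureTheory AddCircle
open scoped ENNReal ComplexConjugate

noncomputable section

namespace GenToeplitz

/-- `L²(𝕋)` with respect to normalized Lebesgue measure. The unit circle is parametrized by
`UnitAddCircle = ℝ/ℤ` through `t ↦ exp (2πit)`, which is `fourier 1`. -/
abbrev L2 : Type := Lp ℂ 2 (haarAddCircle (T := (1 : ℝ)))

/-- `L^∞(𝕋)`. -/
abbrev Linf : Type := Lp ℂ ∞ (haarAddCircle (T := (1 : ℝ)))

/-- The multiplication operator `M_g f = g f` on `L²(𝕋)`, for `g ∈ L^∞(𝕋)`. -/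
def mulOp (g : Linf) : L2 →L[ℂ] L2 :=
  (ContinuousLinearMap.mul ℂ ℂ).holderL haarAddCircle ∞ 2 2 g

theorem coeFn_mulOp (g : Linf) (f : L2) :
    mulOp g f =ᵐ[haarAddCircle] fun t => g t * f t :=
  (ContinuousLinearMap.mul ℂ ℂ).coeFn_holder (r := 2) g f

/-- The Hardy space `H²`, as the closed subspace of `L²(𝕋)` of all boundary functions: those whose
Fourier coefficients of negative index vanish. -/
def H2 : Submodule ℂ L2 where
  carrier := {f | ∀ n : ℤ, n < 0 → fourierCoeff f n = 0}
  zero_mem' := by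
    intro n _
    rw [← fourierBasis_repr]
    simp
  add_mem' := by
    intro f g hf hg n hn
    have h1 := hf n hn
    have h2 := hg n hn
    rw [← fourierBasis_repr] at h1 h2 ⊢
    simp [h1, h2]
  smul_mem' := by
    intro c f hf n hn
    have h1 := hf n hn
    rw [← fourierBasis_repr] at h1 ⊢
    simp [h1]

/-- Inner functions: members `u` of `H^∞` (identified with their boundary functions) with `|u| = 1`
almost everywhere on the circle. -/
structure IsInner (u : Linf) : Prop where
  fourierCoeff_eq_zero : ∀ n : ℤ, n < 0 → fourierCoeff u n = 0
  norm_eq_one : ∀ᵐ t ∂(haarAddCircle (T := (1 : ℝ))), ‖u t‖ = 1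

/-- The function `z ↦ exp (∫ (ζ + z) / (ζ - z) log |f ζ| dm(ζ))` on the unit disc. -/
def outerFunction (f : UnitAddCircle → ℂ) (z : ℂ) : ℂ :=
  Complex.exp (∫ t, (fourier 1 t + z) / (fourier 1 t - z) * (Real.log ‖f t‖ : ℂ) ∂haarAddCircle)

/-- `p ∈ H²` is outer: there are `f` with `log |f|` integrable and a unimodular constant `c` such
that the holomorphic extension `∑ p̂(n) zⁿ` of `p` to the open unit disc is
`c exp (∫ (ζ + z) / (ζ - z) log |f ζ| dm(ζ))`. -/
structure IsOuter (p : L2) : Prop where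
  mem_H2 : p ∈ H2
  exists_eq : ∃ f : UnitAddCircle → ℂ,
    (∀ᵐ t ∂(haarAddCircle (T := (1 : ℝ))), f t ≠ 0) ∧
    Integrable (fun t => Real.log ‖f t‖) (haarAddCircle (T := (1 : ℝ))) ∧
    ∃ c : ℂ, ‖c‖ = 1 ∧ ∀ z : ℂ, ‖z‖ < 1 →
      HasSum (fun n : ℕ => fourierCoeff p (n : ℤ) * z ^ n) (c * outerFunction f z)

/-- `E` is simply invariant: `zE ⊊ E`. -/
def IsSimplyInvariant (E : ClosedSubmodule ℂ L2) : Prop :=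
  E.toSubmodule.map (mulOp (fourierLp ∞ 1) : L2 →ₗ[ℂ] L2) < E.toSubmodule

instance (E : ClosedSubmodule ℂ L2) : CompleteSpace E.toSubmodule :=
  E.isClosed.completeSpace_coe

/-- The generalized Toeplitz operator `T_g^{E₁,E₂} = P_{E₂} (M_g|E₁) : E₁ → E₂`. -/
def toeplitz (E₁ E₂ : ClosedSubmodule ℂ L2) (g : Linf) : E₁.toSubmodule →L[ℂ] E₂.toSubmodule :=
  E₂.toSubmodule.orthogonalProjectionOnto ∘L mulOp g ∘L E₁.toSubmodule.subtypeL

/-- The generalized Toeplitz kernel `ker T_g^{E₁,E₂}`, as a subspace of `L²(𝕋)`. -/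
def toeplitzKer (E₁ E₂ : ClosedSubmodule ℂ L2) (g : Linf) : Submodule ℂ L2 :=
  (LinearMap.ker (toeplitz E₁ E₂ g : E₁.toSubmodule →ₗ[ℂ] E₂.toSubmodule)).map
    E₁.toSubmodule.subtype

theorem toeplitz_eq_zero_iff {E₁ E₂ : ClosedSubmodule ℂ L2} {g : Linf} (x : E₁.toSubmodule) :
    toeplitz E₁ E₂ g x = 0 ↔ mulOp g x ∈ E₂.toSubmoduleᗮ :=
  Submodule.orthogonalProjectionOnto_eq_zero_iff (K := E₂.toSubmodule) (v := mulOp g (x : L2))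

/-- Membership in the kernel: `f ∈ E₁` and `g f ⟂ E₂`. -/
theorem mem_toeplitzKer {E₁ E₂ : ClosedSubmodule ℂ L2} {g : Linf} {f : L2} :
    f ∈ toeplitzKer E₁ E₂ g ↔ f ∈ E₁.toSubmodule ∧ mulOp g f ∈ E₂.toSubmoduleᗮ := by
  constructor
  · rintro ⟨x, hx, rfl⟩
    exact ⟨x.2, (toeplitz_eq_zero_iff x).1 hx⟩
  · rintro ⟨h1, h2⟩
    exact ⟨⟨f, h1⟩, (toeplitz_eq_zero_iff ⟨f, h1⟩).2 h2, rfl⟩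

/-- `K` is the minimal generalized Toeplitz kernel `K_min^{E₁,E₂}(k)`: the smallest subspace among
all kernels `ker T_g^{E₁,E₂}`, `g ∈ L^∞(𝕋)`, that contain `k`. -/
def IsMinimalKernel (E₁ E₂ : ClosedSubmodule ℂ L2) (k : L2) (K : Submodule ℂ L2) : Prop :=
  IsLeast {K' : Submodule ℂ L2 | k ∈ K' ∧ ∃ g : Linf, K' = toeplitzKer E₁ E₂ g} K

/-- The function `Θ₂ * conj (θ * z * p) / p` on the circle. -/
def minimalSymbol (Θ₂ θ : Linf) (p : L2) (t : UnitAddCircle) : ℂ :=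
  Θ₂ t * conj (θ t * fourier 1 t * p t) / p t

end GenToeplitz

end

open Filter Topology

namespace GenToeplitz

-- Since `E₂ = Θ₂H²`, a function `f ∈ E₁` lies in the kernel of symbol `g` exactly when `conj Θ₂ · g
-- f` has only negative frequencies. For `f = θp` and the minimal symbol this function is `conj (z
-- p)`, so `k` is in its kernel.
--
-- For minimality, let `g` have `k` in its kernel and let `f` lie in the kernel of the minimal
-- symbol. Then `A = conj Θ₂ · g θ p` and `B = conj (θ z p) / p · f` have only negative frequencies,
-- and `z A B = s · conj p` with `s = conj Θ₂ · g f`. So `s · conj p` has only negative frequencies,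
-- and `conj p` must be cancelled.
--
-- The cancellation is the cyclicity of outer functions (`IsOuter.integral_eq_zero`). On the disc
-- the extension `P` of `p` is `c exp` of a Herglotz integral; truncating the logarithm from below
-- gives a bounded analytic `G` with `|GP| ≤ 1` and `(GP)(0)` near `1`, which forces `GP` near `1`
-- in quadratic mean. Everything is done on circles of radius `r < 1`, with `P(r·) → p` in `L²`, so
-- no pointwise boundary limits are needed, nor any relation between `|f|` and `|p|` on the circle.

local notation "μ₀" => haarAddCircle (T := (1 : ℝ))

/-! ### Characters, power series and dilates on circles of radius `r < 1` -/

theorem norm_fourier_apply (n : ℤ) (t : UnitAddCircle) : ‖fourier n t‖ = 1 := by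
  rw [fourier_apply]; exact Circle.norm_coe _

theorem fourier_one_pow (k : ℕ) (t : UnitAddCircle) : (fourier 1 t : ℂ) ^ k = fourier (k : ℤ) t := by
  induction k with
  | zero => rw [pow_zero, Nat.cast_zero, fourier_zero]
  | succ k ih => rw [pow_succ, ih, Nat.cast_succ, fourier_add]

theorem integrable_of_continuous {E : Type*} [NormedAddCommGroup E] {f : UnitAddCircle → E}
    (hf : Continuous f) : Integrable f μ₀ :=
  hf.integrable_of_hasCompactSupport (HasCompactSupport.of_compactSpace _)

theorem integral_fourier_eq_zero {n : ℤ} (hn : n ≠ 0) : ∫ t, fourier n t ∂μ₀ = 0 :=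
  integral_eq_zero_of_add_right_eq_neg (μ := μ₀) (fourier_add_half_inv_index hn one_pos)

/-- The Cauchy–Schwarz inequality for the bilinear pairing of two square-integrable functions. -/
theorem norm_integral_mul_le {α : Type*} [MeasurableSpace α] {μ : Measure α} {x y : α → ℂ}
    (hx : MemLp x 2 μ) (hy : MemLp y 2 μ) :
    ‖∫ t, x t * y t ∂μ‖ ≤ √(∫ t, ‖x t‖ ^ 2 ∂μ) * √(∫ t, ‖y t‖ ^ 2 ∂μ) := by
  refine (norm_integral_le_integral_norm _).trans ?_
  have h := integral_mul_le_Lp_mul_Lq_of_nonneg (μ := μ) Real.HolderConjugate.two_two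
    (f := fun t => ‖x t‖) (g := fun t => ‖y t‖) (.of_forall fun _ => norm_nonneg _)
    (.of_forall fun _ => norm_nonneg _) (by simpa using hx.norm) (by simpa using hy.norm)
  simpa only [norm_mul, Real.rpow_two, ← Real.sqrt_eq_rpow] using h

theorem norm_mul_fourier_lt_one {r : ℝ} (hr0 : 0 ≤ r) (hr1 : r < 1) (t : UnitAddCircle) :
    ‖(r : ℂ) * fourier 1 t‖ < 1 := by
  rw [norm_mul, norm_fourier_apply, Complex.norm_real, Real.norm_of_nonneg hr0, mul_one]
  exact hr1

/-- Termwise integration of a power series on a circle of radius `r < 1` against an integrable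
function. -/
theorem hasSum_integral_mul_powerSeries {a : ℕ → ℂ} {F : ℂ → ℂ}
    (hF : ∀ z : ℂ, ‖z‖ < 1 → HasSum (fun n => a n * z ^ n) (F z)) {x : UnitAddCircle → ℂ}
    (hx : Integrable x μ₀) {r : ℝ} (hr0 : 0 ≤ r) (hr1 : r < 1) :
    HasSum (fun n : ℕ => a n * r ^ n * ∫ t, x t * fourier (n : ℤ) t ∂μ₀)
      (∫ t, x t * F (r * fourier 1 t) ∂μ₀) := by
  have hs : Summable fun n => ‖a n * (r : ℂ) ^ n‖ := by
    refine (hF r ?_).summable.norm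
    rwa [Complex.norm_real, Real.norm_of_nonneg hr0]
  have key : ∀ t, HasSum (fun n : ℕ => a n * (r : ℂ) ^ n * (x t * fourier (n : ℤ) t))
      (x t * F (r * fourier 1 t)) := fun t => by
    have h := (hF _ (norm_mul_fourier_lt_one hr0 hr1 t)).mul_left (x t)
    simp only [mul_pow, fourier_one_pow] at h
    rwa [show (fun n : ℕ => a n * (r : ℂ) ^ n * (x t * fourier (n : ℤ) t)) =
      fun n : ℕ => x t * (a n * ((r : ℂ) ^ n * fourier (n : ℤ) t)) by ext; ring]
  have hi : ∀ n : ℕ, Integrable (fun t => a n * (r : ℂ) ^ n * (x t * fourier (n : ℤ) t)) μ₀ :=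
    fun n => by
      refine Integrable.const_mul ?_ _
      simpa only [smul_eq_mul, mul_comm] using hx.fourier_smul (n : ℤ)
  have h := hasSum_integral_of_summable_integral_norm hi (by
    simp only [norm_mul _ (_ * _), norm_mul _ (fourier _ _), norm_fourier_apply, mul_one,
      integral_const_mul]
    exact hs.mul_right _)
  simp only [integral_const_mul] at h
  rwa [integral_congr_ae (.of_forall fun t => (key t).tsum_eq)] at h

theorem exists_hasSum_of_differentiableOn {F : ℂ → ℂ} (hF : DifferentiableOn ℂ F (Metric.ball 0 1)) :
    ∃ a : ℕ → ℂ, ∀ z : ℂ, ‖z‖ < 1 → HasSum (fun n => a n * z ^ n) (F z) := by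
  refine ⟨fun n => (n.factorial : ℂ)⁻¹ * iteratedDeriv n F 0, fun z hz => ?_⟩
  have h := Complex.hasSum_taylorSeries_on_ball (r := 1) (c := 0) (f := F) (by simpa using hF)
    (z := z) (by simpa using hz)
  simp only [sub_zero, smul_eq_mul, ← mul_assoc, mul_right_comm _ (z ^ _)] at h
  exact h

theorem continuous_comp_mul_fourier {F : ℂ → ℂ} (hF : DifferentiableOn ℂ F (Metric.ball 0 1))
    {r : ℝ} (hr0 : 0 ≤ r) (hr1 : r < 1) :
    Continuous fun t : UnitAddCircle => F (r * fourier 1 t) :=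
  hF.continuousOn.comp_continuous (by fun_prop) fun t => by
    simpa using norm_mul_fourier_lt_one hr0 hr1 t

/-- Mean value property: integrating the Taylor series termwise leaves only the constant term. -/
theorem integral_comp_mul_fourier {F : ℂ → ℂ} (hF : DifferentiableOn ℂ F (Metric.ball 0 1))
    {r : ℝ} (hr0 : 0 ≤ r) (hr1 : r < 1) :
    ∫ t, F (r * fourier 1 t) ∂μ₀ = F 0 := by
  obtain ⟨a, ha⟩ := exists_hasSum_of_differentiableOn hF
  have h1 := hasSum_integral_mul_powerSeries ha (integrable_const (1 : ℂ)) hr0 hr1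
  simp only [one_mul] at h1
  have h2 := hasSum_single (f := fun n : ℕ => a n * (r : ℂ) ^ n * ∫ t, fourier (n : ℤ) t ∂μ₀) 0
    fun n hn => by rw [integral_fourier_eq_zero (by exact_mod_cast hn), mul_zero]
  have h3 := hasSum_single (f := fun n : ℕ => a n * (0 : ℂ) ^ n) 0 fun n hn => by simp [hn]
  have h4 := (ha 0 (by simp)).unique h3
  rw [h1.unique h2, h4]
  simp

/-- An analytic function bounded by `1` is close to `1` in quadratic mean on circles as soon as its
value at the origin is close to `1`. -/
theorem integral_norm_one_sub_sq_le {F : ℂ → ℂ} (hF : DifferentiableOn ℂ F (Metric.ball 0 1))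
    (hb : ∀ z : ℂ, ‖z‖ < 1 → ‖F z‖ ≤ 1) {r : ℝ} (hr0 : 0 ≤ r) (hr1 : r < 1) :
    ∫ t, ‖1 - F (r * fourier 1 t)‖ ^ 2 ∂μ₀ ≤ 2 - 2 * (F 0).re := by
  have hc := continuous_comp_mul_fourier hF hr0 hr1
  have hi : Integrable (fun t => F (r * fourier 1 t)) μ₀ :=
    integrable_of_continuous hc
  have hi' : Integrable (fun t => 2 * (F (r * fourier 1 t)).re) μ₀ := hi.re.const_mul 2
  have hre : ∫ t, (F (r * fourier 1 t)).re ∂μ₀ = (F 0).re := by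
    rw [← integral_comp_mul_fourier hF hr0 hr1]
    exact integral_re hi
  -- Pointwise, `|1 - F|² = 1 - 2 Re F + |F|² ≤ 2 - 2 Re F`; the mean of `Re F` is its value at the
  -- origin.
  calc ∫ t, ‖1 - F (r * fourier 1 t)‖ ^ 2 ∂μ₀
      ≤ ∫ t, (2 - 2 * (F (r * fourier 1 t)).re) ∂μ₀ := by
        refine integral_mono ?_ ?_ fun t => ?_
        · exact integrable_of_continuous ((continuous_const.sub hc).norm.pow 2)
        · exact integrable_of_continuous
            (continuous_const.sub (continuous_const.mul (Complex.continuous_re.comp hc)))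
        · have h1 := hb _ (norm_mul_fourier_lt_one hr0 hr1 t)
          have h2 : ‖F (r * fourier 1 t)‖ ^ 2 ≤ 1 := by
            nlinarith [norm_nonneg (F (r * fourier 1 t))]
          rw [Complex.sq_norm, Complex.normSq_apply] at h2 ⊢
          simp only [Complex.sub_re, Complex.one_re, Complex.sub_im, Complex.one_im]
          nlinarith
    _ = 2 - 2 * (F 0).re := by
        rw [integral_sub (integrable_const _) hi', integral_const_mul, hre]
        simp

/-- The dilates `t ↦ P (r e^{2πit})` of the holomorphic extension of `p ∈ H²` converge to `p`
in quadratic mean. -/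
theorem tendsto_integral_norm_dilate_sub_sq {p : L2} (hp : p ∈ H2) {P : ℂ → ℂ}
    (hP : ∀ z : ℂ, ‖z‖ < 1 → HasSum (fun n : ℕ => fourierCoeff p (n : ℤ) * z ^ n) (P z))
    (hPd : DifferentiableOn ℂ P (Metric.ball 0 1)) :
    Tendsto (fun r : ℝ => ∫ t, ‖P (r * fourier 1 t) - p t‖ ^ 2 ∂μ₀) (𝓝[<] 1) (𝓝 0) := by
  have hp1 : Integrable p μ₀ := (Lp.memLp p).integrable (by norm_num)
  have hev : ∀ᶠ r : ℝ in 𝓝[<] 1, r ∈ Set.Ioo (0 : ℝ) 1 := Ioo_mem_nhdsLT one_pos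
  have hcoef : ∀ r ∈ Set.Ioo (0 : ℝ) 1, ∀ n : ℤ,
      fourierCoeff (fun t : UnitAddCircle => P (r * fourier 1 t) - p t) n =
        ((r : ℂ) ^ n.toNat - 1) * fourierCoeff p n := by
    intro r hr n
    have hc := continuous_comp_mul_fourier hPd hr.1.le hr.2
    have hi : Integrable (fun t => P (r * fourier 1 t)) μ₀ :=
      integrable_of_continuous hc
    have hn := hasSum_integral_mul_powerSeries hP (x := fun t : UnitAddCircle => fourier (-n) t)
      (integrable_of_continuous (map_continuous (fourier (-n)))) hr.1.le hr.2
    have h1 : fourierCoeff (fun t : UnitAddCircle => P (r * fourier 1 t)) n =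
        (r : ℂ) ^ n.toNat * fourierCoeff p n := by
      simp only [← fourier_add (T := (1 : ℝ))] at hn
      -- Only `m = n` can survive. For `n < 0` the truncation `n.toNat = 0` is harmless: that
      -- integral vanishes, and so does the coefficient of `p`.
      have h2 := hasSum_single (f := fun m : ℕ => fourierCoeff p (m : ℤ) * (r : ℂ) ^ m *
        ∫ t, (fourier (-n + (m : ℤ)) t : ℂ) ∂μ₀) n.toNat fun m hm => by
          by_cases hmn : -n + (m : ℤ) = 0
          · omega
          · rw [integral_fourier_eq_zero hmn, mul_zero]
      have h3 : fourierCoeff (fun t : UnitAddCircle => P (r * fourier 1 t)) n =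
          ∫ t : UnitAddCircle, fourier (-n) t * P (r * fourier 1 t) ∂μ₀ := rfl
      rw [h3, hn.unique h2]
      rcases lt_or_ge n 0 with h | h
      · rw [hp n h, integral_fourier_eq_zero (by omega)]; simp
      · have e : -n + (n.toNat : ℤ) = 0 := by omega
        rw [e, Int.toNat_of_nonneg h]
        simp [mul_comm]
    have := congrFun (fourierCoeff.add hi hp1.neg) n
    simp only [Pi.add_apply] at this
    rw [show (fun t => P (r * fourier 1 t) - p t) = (fun t : UnitAddCircle => P (r * fourier 1 t)) + -⇑p by
      ext; simp [sub_eq_add_neg], this, h1]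
    have h4 := fourierCoeff.const_smul (⇑p) (-1 : ℂ) n
    simp only [neg_smul, one_smul] at h4
    rw [h4]; ring
  have hlim : Tendsto (fun r : ℝ => ∑' n : ℤ, ‖((r : ℂ) ^ n.toNat - 1) * fourierCoeff p n‖ ^ 2)
      (𝓝[<] 1) (𝓝 (∑' _ : ℤ, 0)) := by
    refine tendsto_tsum_of_dominated_convergence (hasSum_sq_fourierCoeff p).summable ?_ ?_
    · intro n
      have : Continuous fun r : ℝ => ‖((r : ℂ) ^ n.toNat - 1) * fourierCoeff p n‖ ^ 2 := by fun_prop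
      have h := this.tendsto 1
      simp only [Complex.ofReal_one, one_pow, sub_self, zero_mul, norm_zero, ne_eq,
        OfNat.ofNat_ne_zero, not_false_eq_true, zero_pow] at h
      exact h.mono_left nhdsWithin_le_nhds
    · filter_upwards [hev] with r hr n
      rw [Real.norm_of_nonneg (by positivity), norm_mul]
      have h1 : ‖(r : ℂ) ^ n.toNat - 1‖ ≤ 1 := by
        rw [← Complex.ofReal_pow, ← Complex.ofReal_one, ← Complex.ofReal_sub, Complex.norm_real,
          Real.norm_eq_abs, abs_le]
        have h2 := pow_le_one₀ hr.1.le hr.2.le (n := n.toNat)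
        have h3 := pow_nonneg hr.1.le n.toNat
        constructor <;> linarith
      have := mul_le_of_le_one_left (norm_nonneg (fourierCoeff p n)) h1
      gcongr
  rw [tsum_zero] at hlim
  refine hlim.congr' ?_
  filter_upwards [hev] with r hr
  have hm : MemLp (fun t => P (r * fourier 1 t) - p t) 2 μ₀ :=
    MemLp.sub ((continuous_comp_mul_fourier hPd hr.1.le hr.2).memLp_of_hasCompactSupport
      (HasCompactSupport.of_compactSpace _)) (Lp.memLp p)
  have h := tsum_sq_fourierCoeff hm.toLp
  rw [fourierCoeff_congr_ae hm.coeFn_toLp] at h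
  simp only [hcoef r hr] at h
  rw [h]
  refine integral_congr_ae ?_
  filter_upwards [hm.coeFn_toLp] with t ht
  rw [ht]

/-! ### Herglotz integrals -/

/-- The Herglotz integral of a real function on the circle. -/
noncomputable def herglotz (w : UnitAddCircle → ℝ) (z : ℂ) : ℂ :=
  ∫ t, (fourier 1 t + z) / (fourier 1 t - z) * (w t : ℂ) ∂μ₀

theorem one_sub_norm_le (z : ℂ) (t : UnitAddCircle) : 1 - ‖z‖ ≤ ‖fourier 1 t - z‖ := by
  have h := norm_sub_norm_le (fourier 1 t) z
  rwa [norm_fourier_apply] at h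

theorem fourier_sub_ne_zero {z : ℂ} (hz : ‖z‖ < 1) (t : UnitAddCircle) : fourier 1 t - z ≠ 0 :=
  norm_pos_iff.1 ((sub_pos.2 hz).trans_le (one_sub_norm_le z t))

theorem continuous_herglotzKernel {z : ℂ} (hz : ‖z‖ < 1) :
    Continuous fun t : UnitAddCircle => (fourier 1 t + z) / (fourier 1 t - z) :=
  ((map_continuous (fourier 1)).add continuous_const).div₀
    ((map_continuous (fourier 1)).sub continuous_const) (fourier_sub_ne_zero hz)

theorem integrable_continuous_mul {g : UnitAddCircle → ℂ} (hg : Continuous g)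
    {x : UnitAddCircle → ℂ} (hx : Integrable x μ₀) : Integrable (fun t => g t * x t) μ₀ := by
  obtain ⟨C, hC⟩ := isCompact_univ.exists_bound_of_continuousOn hg.continuousOn
  exact hx.bdd_mul hg.aestronglyMeasurable (.of_forall fun t => hC t (Set.mem_univ t))

theorem integrable_herglotz {w : UnitAddCircle → ℝ} (hw : Integrable w μ₀) {z : ℂ} (hz : ‖z‖ < 1) :
    Integrable (fun t => (fourier 1 t + z) / (fourier 1 t - z) * (w t : ℂ)) μ₀ :=
  integrable_continuous_mul (continuous_herglotzKernel hz) hw.ofReal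

theorem herglotz_add {v w : UnitAddCircle → ℝ} (hv : Integrable v μ₀) (hw : Integrable w μ₀) {z : ℂ}
    (hz : ‖z‖ < 1) : herglotz (fun t => v t + w t) z = herglotz v z + herglotz w z := by
  simp only [herglotz, Complex.ofReal_add, mul_add]
  exact integral_add (integrable_herglotz hv hz) (integrable_herglotz hw hz)

theorem herglotz_zero (w : UnitAddCircle → ℝ) : herglotz w 0 = (∫ t, w t ∂μ₀ : ℝ) := by
  rw [herglotz, ← integral_complex_ofReal]
  refine integral_congr_ae (.of_forall fun t => ?_)
  have : (fourier 1 t : ℂ) ≠ 0 := by simp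
  simp only [add_zero, sub_zero, div_self this, one_mul]

theorem differentiableOn_herglotz {w : UnitAddCircle → ℝ} (hw : Integrable w μ₀) :
    DifferentiableOn ℂ (herglotz w) (Metric.ball 0 1) := by
  intro z₀ hz₀
  rw [mem_ball_zero_iff] at hz₀
  -- Half the distance from `z₀` to the circle, so `|ζ - z| ≥ ρ` on the ball of radius `ρ`.
  set ρ := (1 - ‖z₀‖) / 2 with hρ
  have hρ0 : 0 < ρ := by linarith
  have hs : ∀ z ∈ Metric.ball z₀ ρ, ‖z‖ < 1 - ρ := fun z hz => by
    rw [mem_ball_iff_norm] at hz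
    have := norm_sub_norm_le z z₀
    linarith
  have h := hasDerivAt_integral_of_dominated_loc_of_deriv_le (μ := μ₀) (𝕜 := ℂ)
    (F := fun z t => (fourier 1 t + z) / (fourier 1 t - z) * (w t : ℂ))
    (F' := fun z t => 2 * fourier 1 t / (fourier 1 t - z) ^ 2 * (w t : ℂ))
    (bound := fun t => 2 / ρ ^ 2 * ‖w t‖) (Metric.ball_mem_nhds z₀ hρ0) ?_
    (integrable_herglotz hw hz₀) ?_ ?_ (hw.norm.const_mul _) ?_
  · exact h.2.differentiableAt.differentiableWithinAt
  · filter_upwards [Metric.ball_mem_nhds z₀ hρ0] with z hz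
    exact (integrable_herglotz hw ((hs z hz).trans (by linarith))).aestronglyMeasurable
  · refine (integrable_continuous_mul ?_ hw.ofReal).aestronglyMeasurable
    exact (continuous_const.mul (map_continuous (fourier 1))).div₀
      (((map_continuous (fourier 1)).sub continuous_const).pow 2)
      fun t => pow_ne_zero 2 (fourier_sub_ne_zero hz₀ t)
  · refine .of_forall fun t z hz => ?_
    have h1 : ρ ≤ ‖fourier 1 t - z‖ := by
      have := one_sub_norm_le z t
      linarith [hs z hz]
    rw [norm_mul, norm_div, norm_mul, norm_pow, norm_fourier_apply, Complex.norm_real, mul_one,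
      Complex.norm_ofNat]
    gcongr
  · refine .of_forall fun t z hz => ?_
    have h0 := fourier_sub_ne_zero ((hs z hz).trans (by linarith)) t
    have h1 := (((hasDerivAt_id z).const_add (fourier 1 t)).fun_div
      ((hasDerivAt_id z).const_sub (fourier 1 t)) h0).mul_const (w t : ℂ)
    refine h1.congr_deriv ?_
    simp only [id]
    congr 2
    ring

/-- The real part of the kernel is the Poisson kernel `(1 - |z|²) / |ζ - z|²`. -/
theorem herglotz_re_nonneg {w : UnitAddCircle → ℝ} (hw : Integrable w μ₀) (h0 : ∀ t, 0 ≤ w t) {z : ℂ}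
    (hz : ‖z‖ < 1) : 0 ≤ (herglotz w z).re := by
  have h := integral_re (integrable_herglotz hw hz)
  change _ = (herglotz w z).re at h
  rw [← h]
  refine integral_nonneg fun t => ?_
  change 0 ≤ ((fourier 1 t + z) / (fourier 1 t - z) * (w t : ℂ)).re
  rw [Complex.re_mul_ofReal]
  refine mul_nonneg ?_ (h0 t)
  have h1 : (fourier 1 t + z) / (fourier 1 t - z) =
      (fourier 1 t + z) * conj (fourier 1 t - z) / (Complex.normSq (fourier 1 t - z) : ℂ) := by
    rw [← Complex.mul_conj, mul_div_mul_right]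
    exact (map_ne_zero _).2 (fourier_sub_ne_zero hz t)
  rw [h1, Complex.div_ofReal_re]
  refine div_nonneg ?_ (Complex.normSq_nonneg _)
  have h2 := norm_fourier_apply 1 t
  have h3 : Complex.normSq (fourier 1 t) = 1 := by rw [Complex.normSq_eq_norm_sq, h2, one_pow]
  have h4 : Complex.normSq z ≤ 1 := by
    rw [Complex.normSq_eq_norm_sq]; exact pow_le_one₀ (norm_nonneg z) hz.le
  generalize (fourier 1 t : ℂ) = ζ at *
  rw [Complex.normSq_apply] at h3 h4
  simp only [Complex.mul_re, Complex.conj_re, Complex.conj_im, Complex.add_re, Complex.add_im,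
    Complex.sub_re, Complex.sub_im]
  linarith

/-- On the circle the kernel is the conjugate of `(1 + conj z · ζ) / (1 - conj z · ζ)`, analytic in
`ζ` with value `1` at the origin, so the mean value property applies. -/
theorem herglotz_const (c : ℝ) {z : ℂ} (hz : ‖z‖ < 1) : herglotz (fun _ => c) z = c := by
  -- Writing `conj z = b‖z‖` turns the unit circle into the circle of radius `‖z‖ < 1`; at `z = 0`
  -- division by zero gives `b = 0`.
  set b : ℂ := conj z / ‖z‖ with hb
  have hb1 : ‖b‖ ≤ 1 := by
    rw [hb, norm_div, Complex.norm_conj, Complex.norm_real, norm_norm]; exact div_self_le_one _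
  have hbz : ∀ u : ℂ, b * (‖z‖ * u) = conj z * u := fun u => by
    rcases eq_or_ne z 0 with rfl | h
    · simp
    · have : (‖z‖ : ℂ) ≠ 0 := by simpa using h
      rw [hb]; field_simp
  have hd : DifferentiableOn ℂ (fun u : ℂ => (1 + b * u) / (1 - b * u)) (Metric.ball 0 1) := by
    intro u hu
    rw [mem_ball_zero_iff] at hu
    refine DifferentiableAt.differentiableWithinAt ?_
    refine DifferentiableAt.fun_div (by fun_prop) (by fun_prop) ?_
    intro h
    have h1 : ‖b * u‖ = 1 := by rw [← sub_eq_zero.1 h, norm_one]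
    rw [norm_mul] at h1
    nlinarith [norm_nonneg b, norm_nonneg u]
  have h := integral_comp_mul_fourier hd (norm_nonneg z) hz
  simp only [hbz, mul_zero, add_zero, sub_zero, div_one] at h
  have h1 : ∀ t : UnitAddCircle, (fourier 1 t + z) / (fourier 1 t - z) =
      conj ((1 + conj z * fourier 1 t) / (1 - conj z * fourier 1 t)) := fun t => by
    have hn : fourier 1 t * conj (fourier 1 t : ℂ) = 1 := by
      rw [Complex.mul_conj, Complex.normSq_eq_norm_sq, norm_fourier_apply]; simp
    have h0 : conj (fourier 1 t : ℂ) ≠ 0 := right_ne_zero_of_mul_eq_one hn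
    rw [map_div₀, ← mul_div_mul_right _ _ h0]
    simp only [map_add, map_sub, map_mul, map_one, Complex.conj_conj, add_mul, sub_mul, hn]
  simp only [herglotz, h1, integral_mul_const, integral_conj, h, map_one, one_mul]

theorem herglotz_re_le_zero {w : UnitAddCircle → ℝ} (hw : Integrable w μ₀) (h0 : ∀ t, w t ≤ 0) {z : ℂ}
    (hz : ‖z‖ < 1) : (herglotz w z).re ≤ 0 := by
  have h1 := herglotz_re_nonneg hw.neg (fun t => neg_nonneg.2 (h0 t)) hz
  have h2 := herglotz_add hw hw.neg hz
  have h3 := herglotz_const 0 hz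
  simp only [Pi.neg_apply, add_neg_cancel, h3] at h2
  have h4 := congrArg Complex.re h2
  simp only [Complex.add_re, Complex.ofReal_re] at h4
  change 0 ≤ (herglotz (fun t => -w t) z).re at h1
  change 0 = _ + (herglotz (fun t => -w t) z).re at h4
  linarith

theorem le_herglotz_re {w : UnitAddCircle → ℝ} (hw : Integrable w μ₀) {m : ℝ} (h0 : ∀ t, m ≤ w t)
    {z : ℂ} (hz : ‖z‖ < 1) : m ≤ (herglotz w z).re := by
  have h1 := herglotz_re_nonneg (hw.add (integrable_const (-m)))
    (fun t => by simpa using h0 t) hz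
  have h2 := herglotz_add hw (integrable_const (-m)) hz
  rw [herglotz_const _ hz] at h2
  change 0 ≤ (herglotz (fun t => w t + -m) z).re at h1
  rw [h2] at h1
  simpa using h1

/-! ### Cyclicity of outer functions -/

/-- An outer function splits, for each `N`, as `G P = Q` on the disc, with `G` bounded, `|Q| ≤ 1`
and `Q 0` tending to `1`. -/
theorem exists_bounded_multiplier {u : UnitAddCircle → ℝ} (hu : Integrable u μ₀) {c : ℂ}
    (hc : ‖c‖ = 1) {ε : ℝ} (hε : 0 < ε) :
    ∃ (G : ℂ → ℂ) (C : ℝ), DifferentiableOn ℂ G (Metric.ball 0 1) ∧ (∀ z : ℂ, ‖z‖ < 1 → ‖G z‖ ≤ C) ∧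
      (∀ z : ℂ, ‖z‖ < 1 → ‖G z * (c * Complex.exp (herglotz u z))‖ ≤ 1) ∧
      2 - 2 * (G 0 * (c * Complex.exp (herglotz u 0))).re < ε := by
  have hi1 : ∀ N : ℕ, Integrable (fun t => max (u t) (-(N : ℝ))) μ₀ := fun N =>
    hu.sup (integrable_const _)
  have hi2 : ∀ N : ℕ, Integrable (fun t => min 0 (u t + (N : ℝ))) μ₀ := fun N =>
    (integrable_const _).inf (hu.add (integrable_const _))
  -- Truncation at `-N`: the part bounded below yields the bounded `G`, the nonpositive remainder
  -- yields `GP`.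
  have hsum : ∀ N : ℕ, (fun t => max (u t) (-(N : ℝ)) + min 0 (u t + (N : ℝ))) = u := fun N => by
    ext t
    rcases le_total (u t) (-(N : ℝ)) with h | h
    · rw [max_eq_right h, min_eq_right (by linarith)]; ring
    · rw [max_eq_left h, min_eq_left (by linarith)]; ring
  have hGP : ∀ (N : ℕ) (z : ℂ), ‖z‖ < 1 →
      c⁻¹ * Complex.exp (-herglotz (fun t => max (u t) (-(N : ℝ))) z) *
        (c * Complex.exp (herglotz u z)) =
      Complex.exp (herglotz (fun t => min 0 (u t + (N : ℝ))) z) := fun N z hz => by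
    have hc0 : c ≠ 0 := norm_ne_zero_iff.1 (by rw [hc]; exact one_ne_zero)
    have h := herglotz_add (hi1 N) (hi2 N) hz
    rw [hsum] at h
    rw [mul_mul_mul_comm, inv_mul_cancel₀ hc0, one_mul, ← Complex.exp_add, h]
    congr 1; ring
  have hlim : Tendsto (fun N : ℕ => ∫ t, min 0 (u t + (N : ℝ)) ∂μ₀) atTop (𝓝 (∫ _, 0 ∂μ₀)) := by
    refine tendsto_integral_of_dominated_convergence (fun t => ‖u t‖)
      (fun N => (hi2 N).aestronglyMeasurable) hu.norm ?_ ?_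
    · refine fun N => .of_forall fun t => ?_
      rw [Real.norm_eq_abs, Real.norm_eq_abs, abs_of_nonpos (min_le_left _ _), neg_le]
      have h1 := neg_abs_le (u t)
      have h2 : (0 : ℝ) ≤ N := N.cast_nonneg
      exact le_min (by linarith [abs_nonneg (u t)]) (by linarith)
    · refine .of_forall fun t => tendsto_const_nhds.congr' ?_
      obtain ⟨M, hM⟩ := exists_nat_ge (-u t)
      filter_upwards [eventually_ge_atTop M] with N hN
      have : (M : ℝ) ≤ N := by exact_mod_cast hN
      rw [min_eq_left (by linarith)]
  have hlim2 : Tendsto (fun N : ℕ => 2 - 2 * Real.exp (∫ t, min 0 (u t + (N : ℝ)) ∂μ₀)) atTop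
      (𝓝 (2 - 2 * Real.exp (∫ _ : UnitAddCircle, 0 ∂μ₀))) :=
    ((Real.continuous_exp.tendsto _).comp hlim).const_mul 2 |>.const_sub 2
  rw [integral_zero, Real.exp_zero, mul_one, sub_self] at hlim2
  obtain ⟨N, hN⟩ := (hlim2.eventually_lt_const hε).exists
  refine ⟨fun z => c⁻¹ * Complex.exp (-herglotz (fun t => max (u t) (-(N : ℝ))) z), Real.exp N,
    ?_, ?_, ?_, ?_⟩
  · exact ((differentiableOn_herglotz (hi1 N)).neg.cexp).const_mul _
  · intro z hz
    rw [norm_mul, norm_inv, hc, inv_one, one_mul, Complex.norm_exp, Complex.neg_re, Real.exp_le_exp,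
      neg_le]
    exact le_herglotz_re (hi1 N) (fun t => le_max_right _ _) hz
  · intro z hz
    rw [hGP N z hz, Complex.norm_exp, Real.exp_le_one_iff]
    exact herglotz_re_le_zero (hi2 N) (fun t => min_le_left _ _) hz
  · rw [hGP N 0 (by simp), herglotz_zero, ← Complex.ofReal_exp, Complex.ofReal_re]
    exact hN

/-- Outer functions are cyclic: an `L²` function annihilating `p zᵏ` for all `k ≥ 0` annihilates
the constants. -/
theorem IsOuter.integral_eq_zero {p : L2} (hp : IsOuter p) {x : UnitAddCircle → ℂ}
    (hx : MemLp x 2 μ₀) (h : ∀ k : ℕ, ∫ t, x t * p t * fourier (k : ℤ) t ∂μ₀ = 0) :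
    ∫ t, x t ∂μ₀ = 0 := by
  obtain ⟨hpH, f, -, hu, c, hc, hP⟩ := hp
  set u : UnitAddCircle → ℝ := fun t => Real.log ‖f t‖ with hu_def
  set P : ℂ → ℂ := fun z => c * Complex.exp (herglotz u z) with hP_def
  change ∀ z : ℂ, ‖z‖ < 1 → HasSum _ (P z) at hP
  have hPd : DifferentiableOn ℂ P (Metric.ball 0 1) :=
    (differentiableOn_herglotz hu).cexp.const_mul _
  have hpm : MemLp p 2 μ₀ := Lp.memLp p
  have hxp : Integrable (fun t => x t * p t) μ₀ := hx.integrable_mul hpm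
  set X := √(∫ t, ‖x t‖ ^ 2 ∂μ₀) with hX
  have main : ∀ ε : ℝ, 0 < ε → ‖∫ t, x t ∂μ₀‖ ≤ X * √ε := by
    intro ε hε
    obtain ⟨G, C, hGd, hGC, hQ, hQ0⟩ := exists_bounded_multiplier hu hc hε
    have hQd : DifferentiableOn ℂ (fun z => G z * P z) (Metric.ball 0 1) := hGd.mul hPd
    have hbound : ∀ᶠ r : ℝ in 𝓝[<] 1, ‖∫ t, x t ∂μ₀‖ ≤
        X * √ε + X * (C * √(∫ t, ‖P (r * fourier 1 t) - p t‖ ^ 2 ∂μ₀)) := by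
      filter_upwards [Ioo_mem_nhdsLT (one_pos : (0 : ℝ) < 1)] with r hr
      have hG : Continuous fun t : UnitAddCircle => G (r * fourier 1 t) :=
        continuous_comp_mul_fourier hGd hr.1.le hr.2
      have hPc : Continuous fun t : UnitAddCircle => P (r * fourier 1 t) :=
        continuous_comp_mul_fourier hPd hr.1.le hr.2
      have m1 : MemLp (fun t => 1 - G (r * fourier 1 t) * P (r * fourier 1 t)) 2 μ₀ :=
        (continuous_const.sub (hG.mul hPc)).memLp_of_hasCompactSupport
          (HasCompactSupport.of_compactSpace _)
      have m2 : MemLp (fun t => P (r * fourier 1 t) - p t) 2 μ₀ :=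
        (hPc.memLp_of_hasCompactSupport (HasCompactSupport.of_compactSpace _)).sub hpm
      have hGt : ∀ t : UnitAddCircle, ‖G (r * fourier 1 t)‖ ≤ C := fun t =>
        hGC _ (norm_mul_fourier_lt_one hr.1.le hr.2 t)
      have m3 : MemLp (fun t => G (r * fourier 1 t) * (P (r * fourier 1 t) - p t)) 2 μ₀ :=
        m2.mul' (memLp_top_of_bound hG.aestronglyMeasurable C (.of_forall hGt))
      have hC0 : 0 ≤ C := (norm_nonneg _).trans (hGt 0)
      have i1 := norm_integral_mul_le hx m1
      have i2 := norm_integral_mul_le hx m3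
      have e1 : √(∫ t, ‖1 - G (r * fourier 1 t) * P (r * fourier 1 t)‖ ^ 2 ∂μ₀) ≤ √ε :=
        Real.sqrt_le_sqrt
          ((integral_norm_one_sub_sq_le hQd hQ hr.1.le hr.2).trans hQ0.le)
      have e2 : √(∫ t, ‖G (r * fourier 1 t) * (P (r * fourier 1 t) - p t)‖ ^ 2 ∂μ₀) ≤
          C * √(∫ t, ‖P (r * fourier 1 t) - p t‖ ^ 2 ∂μ₀) := by
        rw [← Real.sqrt_sq hC0, ← Real.sqrt_mul (sq_nonneg C), ← integral_const_mul]
        refine Real.sqrt_le_sqrt (integral_mono_of_nonneg (.of_forall fun t => by positivity)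
          ((memLp_two_iff_integrable_sq_norm m2.1).1 m2 |>.const_mul _) (.of_forall fun t => ?_))
        simp only [norm_mul, mul_pow]
        gcongr
        exact hGt t
      -- `G(rζ)` is a power series in `ζ`, and each monomial is annihilated by hypothesis.
      have e3 : ∫ t, x t * p t * G (r * fourier 1 t) ∂μ₀ = 0 := by
        obtain ⟨a, ha⟩ := exists_hasSum_of_differentiableOn hGd
        have h1 := hasSum_integral_mul_powerSeries ha hxp hr.1.le hr.2
        simp only [h, mul_zero] at h1
        exact h1.unique hasSum_zero
      have j1 : Integrable (fun t => x t * (1 - G (r * fourier 1 t) * P (r * fourier 1 t))) μ₀ :=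
        hx.integrable_mul m1
      have j2 : Integrable (fun t => x t * (G (r * fourier 1 t) * (P (r * fourier 1 t) - p t))) μ₀ :=
        hx.integrable_mul m3
      have j3 : Integrable (fun t => x t * p t * G (r * fourier 1 t)) μ₀ := by
        simpa only [mul_comm] using integrable_continuous_mul hG hxp
      -- Uses `1 = (1 - G_r P_r) + G_r (P_r - p) + G_r p`: the first term is small by choice of `G`,
      -- the second as `r → 1`, and the third contributes nothing.
      have e4 : ∫ t, x t ∂μ₀ =
          ∫ t, x t * (1 - G (r * fourier 1 t) * P (r * fourier 1 t)) ∂μ₀ +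
          ∫ t, x t * (G (r * fourier 1 t) * (P (r * fourier 1 t) - p t)) ∂μ₀ +
          ∫ t, x t * p t * G (r * fourier 1 t) ∂μ₀ := by
        have j12 := integral_add (j1.add j2) j3
        simp only [Pi.add_apply] at j12
        rw [← integral_add j1 j2, ← j12]
        exact integral_congr_ae (.of_forall fun t => by ring)
      rw [e4, e3, add_zero]
      have hX0 : 0 ≤ X := Real.sqrt_nonneg _
      exact (norm_add_le _ _).trans (add_le_add
        (i1.trans (mul_le_mul_of_nonneg_left e1 hX0)) (i2.trans (mul_le_mul_of_nonneg_left e2 hX0)))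
    have hlim := (((tendsto_integral_norm_dilate_sub_sq hpH hP hPd).sqrt.const_mul C).const_mul
      X).const_add (X * √ε)
    rw [Real.sqrt_zero, mul_zero, mul_zero, add_zero] at hlim
    exact ge_of_tendsto hlim hbound
  have hl : Tendsto (fun ε : ℝ => X * √ε) (𝓝[>] 0) (𝓝 0) := by
    have : Tendsto (fun ε : ℝ => X * √ε) (𝓝 0) (𝓝 (X * √0)) :=
      (continuous_const.mul Real.continuous_sqrt).tendsto 0
    rw [Real.sqrt_zero, mul_zero] at this
    exact this.mono_left nhdsWithin_le_nhds
  exact norm_le_zero_iff.1 (ge_of_tendsto hl (by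
    filter_upwards [self_mem_nhdsWithin] with ε hε using main ε hε))

/-- The indicator of the zero set annihilates every `p zᵏ`, so by cyclicity its integral, the
measure of that set, is zero. -/
theorem IsOuter.ae_ne_zero {p : L2} (hp : IsOuter p) : ∀ᵐ t ∂μ₀, p t ≠ 0 := by
  have hS : MeasurableSet {t | p t = 0} := (Lp.stronglyMeasurable p).measurable (measurableSet_singleton 0)
  have h := hp.integral_eq_zero (x := Set.indicator {t | p t = 0} fun _ => 1)
    (memLp_indicator_const 2 hS 1 (Or.inr (measure_ne_top _ _))) fun k => by
      refine integral_eq_zero_of_ae (.of_forall fun t => ?_)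
      by_cases ht : p t = 0
      · simp [ht]
      · simp [Set.indicator_of_notMem (s := {t | p t = 0}) ht]
  rw [integral_indicator_const _ hS] at h
  rw [ae_iff]
  simpa [Measure.real, ENNReal.toReal_eq_zero_iff] using h

/-! ### Fourier supports and orthogonality to `ΘH²` -/

theorem fourierCoeff_conj (a : UnitAddCircle → ℂ) (n : ℤ) :
    fourierCoeff (fun t => conj (a t)) n = conj (fourierCoeff a (-n)) := by
  simp only [fourierCoeff]
  rw [← integral_conj]
  refine integral_congr_ae (.of_forall fun t => ?_)
  simp only [smul_eq_mul, map_mul, ← fourier_neg, neg_neg]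

theorem fourierCoeff_fourier_mul (m : ℤ) (a : UnitAddCircle → ℂ) (n : ℤ) :
    fourierCoeff (fun t => fourier m t * a t) n = fourierCoeff a (n - m) := by
  refine integral_congr_ae (.of_forall fun t => ?_)
  simp only [smul_eq_mul, ← mul_assoc, ← fourier_add]
  rw [show -n + m = -(n - m) by ring]

theorem memLp_conj {a : UnitAddCircle → ℂ} (ha : MemLp a 2 μ₀) :
    MemLp (fun t => conj (a t)) 2 μ₀ :=
  ha.star

theorem memLp_fourier_mul (m : ℤ) {a : UnitAddCircle → ℂ} (ha : MemLp a 2 μ₀) :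
    MemLp (fun t => fourier m t * a t) 2 μ₀ :=
  ha.mul' (memLp_top_of_bound (map_continuous (fourier m)).aestronglyMeasurable 1
    (.of_forall fun t => (norm_fourier_apply m t).le))

theorem memLp_conj_mul (g : Linf) (v : L2) : MemLp (fun t => conj (g t) * v t) 2 μ₀ :=
  (Lp.memLp v).mul' (p := ∞) (Lp.memLp g).star

/-- A form of Parseval's identity: the integral of a product vanishes when the Fourier supports
of the factors are disjoint up to reflection. -/
theorem integral_mul_eq_zero {a b : UnitAddCircle → ℂ} (ha : MemLp a 2 μ₀) (hb : MemLp b 2 μ₀)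
    (h : ∀ n : ℤ, fourierCoeff a (-n) = 0 ∨ fourierCoeff b n = 0) : ∫ t, a t * b t ∂μ₀ = 0 := by
  have hc := memLp_conj ha
  have h1 := fourierBasis.tsum_inner_mul_inner hc.toLp hb.toLp
  have h2 : ∀ n : ℤ, inner ℂ hc.toLp (fourierBasis n) * inner ℂ (fourierBasis n) hb.toLp = 0 := by
    intro n
    rw [← inner_conj_symm, ← fourierBasis.repr_apply_apply, ← fourierBasis.repr_apply_apply,
      fourierBasis_repr, fourierBasis_repr, fourierCoeff_congr_ae hc.coeFn_toLp,
      fourierCoeff_congr_ae hb.coeFn_toLp, fourierCoeff_conj, Complex.conj_conj]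
    rcases h n with h | h <;> rw [h] <;> ring
  simp only [h2, tsum_zero] at h1
  rw [h1, L2.inner_def]
  refine integral_congr_ae ?_
  filter_upwards [hc.coeFn_toLp, hb.coeFn_toLp] with t h3 h4
  rw [RCLike.inner_apply', h3, h4]
  simp

theorem fourierLp_mem_H2 {n : ℤ} (hn : 0 ≤ n) : fourierLp 2 n ∈ H2 := by
  intro m hm
  have h : (fourierLp 2 n : UnitAddCircle → ℂ) =ᵐ[μ₀] fun t => fourier n t * 1 := by
    simpa only [mul_one] using coeFn_fourierLp 2 n
  rw [fourierCoeff_congr_ae h, fourierCoeff_fourier_mul]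
  simp only [fourierCoeff, smul_eq_mul, mul_one]
  exact integral_fourier_eq_zero (by omega)

/-- Moving `Θ` across the inner product reduces the condition to orthogonality of `conj Θ · v` to
`H²`, tested on the characters. -/
theorem mem_orthogonal_map_mulOp_iff {Θ : Linf} {v : L2} :
    v ∈ (H2.map (mulOp Θ : L2 →ₗ[ℂ] L2))ᗮ ↔
      ∀ n : ℤ, 0 ≤ n → fourierCoeff (fun t => conj (Θ t) * v t) n = 0 := by
  have key : ∀ h : L2, inner ℂ (mulOp Θ h) v = ∫ t, conj (h t) * (conj (Θ t) * v t) ∂μ₀ := by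
    intro h
    rw [L2.inner_def]
    refine integral_congr_ae ?_
    filter_upwards [coeFn_mulOp Θ h] with t ht
    rw [RCLike.inner_apply', ht, map_mul]
    ring
  rw [Submodule.mem_orthogonal]
  constructor
  · intro H n hn
    have h := H _ (Submodule.mem_map_of_mem (fourierLp_mem_H2 hn))
    rw [ContinuousLinearMap.coe_coe, key] at h
    rw [← h]
    refine integral_congr_ae ?_
    filter_upwards [coeFn_fourierLp 2 n] with t ht
    rw [ht, fourier_neg, smul_eq_mul]
  · rintro H _ ⟨h, hh, rfl⟩
    rw [ContinuousLinearMap.coe_coe, key]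
    refine integral_mul_eq_zero (memLp_conj (Lp.memLp h)) (memLp_conj_mul Θ v) fun n => ?_
    rcases lt_or_ge n 0 with hn | hn
    · left
      rw [fourierCoeff_conj, neg_neg, hh n hn, map_zero]
    · exact Or.inr (H n hn)

theorem IsInner.ae_conj_mul_self {u : Linf} (hu : IsInner u) : ∀ᵐ t ∂μ₀, conj (u t) * u t = 1 := by
  filter_upwards [hu.norm_eq_one] with t ht
  rw [mul_comm, Complex.mul_conj, Complex.normSq_eq_norm_sq, ht]
  simp

/-! ### The minimal symbol -/

theorem memLp_minimalSymbol {Θ₂ θ : Linf} (hΘ₂ : IsInner Θ₂) (hθ : IsInner θ) (p : L2) :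
    MemLp (minimalSymbol Θ₂ θ p) ∞ μ₀ := by
  refine memLp_top_of_bound ?_ 1 ?_
  · have h1 := (Lp.stronglyMeasurable Θ₂).measurable
    have h2 := (Lp.stronglyMeasurable θ).measurable
    have h3 := (Lp.stronglyMeasurable p).measurable
    have h4 : Measurable fun t : UnitAddCircle => (fourier 1 t : ℂ) :=
      (map_continuous (fourier 1)).measurable
    exact ((h1.mul (Complex.continuous_conj.measurable.comp ((h2.mul h4).mul h3))).div
      h3).aestronglyMeasurable
  · filter_upwards [hΘ₂.norm_eq_one, hθ.norm_eq_one] with t h1 h2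
    rw [minimalSymbol, norm_div, norm_mul, Complex.norm_conj, norm_mul, norm_mul, h1, h2,
      norm_fourier_apply, one_mul, one_mul, one_mul]
    -- The modulus is `|p| / |p|`, which is `1`, or `0` where `p` vanishes.
    exact div_self_le_one _

theorem ae_mulOp_minimalSymbol {Θ₂ θ : Linf} {p : L2}
    (hg : MemLp (minimalSymbol Θ₂ θ p) ∞ μ₀) (f : L2) :
    mulOp hg.toLp f =ᵐ[μ₀] fun t => Θ₂ t * conj (θ t * fourier 1 t * p t) / p t * f t := by
  filter_upwards [coeFn_mulOp hg.toLp f, hg.coeFn_toLp] with t h1 h2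
  rw [h1, h2, minimalSymbol]

/-- The unimodular factors cancel and leave `conj (z p)`; the factor `z` is what removes frequency
`0`. -/
theorem mulOp_minimalSymbol_mem_orthogonal {Θ₂ θ : Linf} (hΘ₂ : IsInner Θ₂) (hθ : IsInner θ)
    {p : L2} (hp : IsOuter p) (hg : MemLp (minimalSymbol Θ₂ θ p) ∞ μ₀) :
    mulOp hg.toLp (mulOp θ p) ∈ (H2.map (mulOp Θ₂ : L2 →ₗ[ℂ] L2))ᗮ := by
  rw [mem_orthogonal_map_mulOp_iff]
  intro n hn
  have h : (fun t => conj (Θ₂ t) * mulOp hg.toLp (mulOp θ p) t) =ᵐ[μ₀]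
      fun t => conj (fourier 1 t * p t) := by
    filter_upwards [ae_mulOp_minimalSymbol hg (mulOp θ p), coeFn_mulOp θ p, hp.ae_ne_zero,
      hΘ₂.ae_conj_mul_self, hθ.ae_conj_mul_self] with t h1 h2 h3 h4 h5
    rw [h1, h2]
    simp only [map_mul]
    calc _ = (conj (Θ₂ t) * Θ₂ t) * (conj (θ t) * θ t) * (conj (fourier 1 t) * conj (p t)) *
          (p t / p t) := by ring
      _ = _ := by rw [h4, h5, div_self h3]; ring
  rw [fourierCoeff_congr_ae h, fourierCoeff_conj, fourierCoeff_fourier_mul,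
    hp.mem_H2 _ (by omega), map_zero]

/-- If `g` annihilates `k = θ p` modulo `Θ₂ H²`, it annihilates everything the minimal symbol does. -/
theorem mulOp_mem_orthogonal_of_minimalSymbol {Θ₂ θ : Linf} (hΘ₂ : IsInner Θ₂) (hθ : IsInner θ)
    {p : L2} (hp : IsOuter p) (hg : MemLp (minimalSymbol Θ₂ θ p) ∞ μ₀) {g : Linf}
    (hgk : mulOp g (mulOp θ p) ∈ (H2.map (mulOp Θ₂ : L2 →ₗ[ℂ] L2))ᗮ) {f : L2}
    (hf : mulOp hg.toLp f ∈ (H2.map (mulOp Θ₂ : L2 →ₗ[ℂ] L2))ᗮ) :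
    mulOp g f ∈ (H2.map (mulOp Θ₂ : L2 →ₗ[ℂ] L2))ᗮ := by
  rw [mem_orthogonal_map_mulOp_iff] at *
  intro m hm
  have hs := memLp_fourier_mul (-m) (memLp_conj_mul Θ₂ (mulOp g f))
  -- Cyclicity is applied to `conj (z⁻ᵐ s)` with `s = conj Θ₂ · g f`; its integral is the conjugate
  -- of the `m`-th coefficient of `s`.
  have h := hp.integral_eq_zero (memLp_conj hs) fun k => by
    have h0 := integral_mul_eq_zero (memLp_conj_mul Θ₂ (mulOp g (mulOp θ p)))
      -- The `1` absorbs the `conj z` of the minimal symbol. The shifted second factor has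
      -- frequencies at most `0` and the first at most `-1`, so their product has mean zero.
      (memLp_fourier_mul (1 - m - k) (memLp_conj_mul Θ₂ (mulOp hg.toLp f))) fun n => by
        rcases lt_or_ge 0 n with hn | hn
        · right
          rw [fourierCoeff_fourier_mul]
          exact hf _ (by omega)
        · exact Or.inl (hgk _ (by omega))
    rw [← map_zero (starRingEnd ℂ), ← h0, ← integral_conj]
    refine integral_congr_ae ?_
    filter_upwards [ae_mulOp_minimalSymbol hg f, coeFn_mulOp θ p, coeFn_mulOp g (mulOp θ p),
      coeFn_mulOp g f, hp.ae_ne_zero, hΘ₂.ae_conj_mul_self, hθ.ae_conj_mul_self]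
      with t h1 h2 h3 h4 h5 h6 h7
    have hz : (fourier 1 t : ℂ) * conj (fourier 1 t) = 1 := by
      rw [← fourier_neg, ← fourier_add, add_neg_cancel, fourier_zero]
    rw [h1, h3, h2, h4, show 1 - m - (k : ℤ) = 1 + -m + -(k : ℤ) by ring, fourier_add, fourier_add,
      fourier_neg (n := (k : ℤ))]
    have e : conj (Θ₂ t) * (g t * (θ t * p t)) * (fourier 1 t * fourier (-m) t *
        conj (fourier (k : ℤ) t) *
        (conj (Θ₂ t) * (Θ₂ t * conj (θ t * fourier 1 t * p t) / p t * f t))) =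
        fourier (-m) t * (conj (Θ₂ t) * (g t * f t)) * conj (p t) * conj (fourier (k : ℤ) t) := by
      simp only [map_mul]
      calc _ = fourier (-m) t * (conj (Θ₂ t) * (g t * f t)) * conj (p t) *
            conj (fourier (k : ℤ) t) * (conj (Θ₂ t) * Θ₂ t) * (conj (θ t) * θ t) *
            (fourier 1 t * conj (fourier 1 t)) * (p t / p t) := by ring
        _ = _ := by rw [h6, h7, hz, div_self h5]; ring
    rw [e]
    simp only [map_mul, Complex.conj_conj]
  rw [integral_conj, map_eq_zero] at h
  exact h

end GenToeplitz

theorem mainTheorem5 (E₁ E₂ : ClosedSubmodule ℂ GenToeplitz.L2)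
    (hE₁ : E₁.toSubmodule ≤ GenToeplitz.H2) (hE₂ : E₂.toSubmodule ≤ GenToeplitz.H2)
    (hE₂_inv : GenToeplitz.IsSimplyInvariant E₂)
    (Θ₂ : GenToeplitz.Linf) (hΘ₂ : GenToeplitz.IsInner Θ₂)
    (hE₂_eq : E₂.toSubmodule =
      GenToeplitz.H2.map (GenToeplitz.mulOp Θ₂ : GenToeplitz.L2 →ₗ[ℂ] GenToeplitz.L2))
    (k : GenToeplitz.L2) (hk : k ∈ E₁.toSubmodule)
    (θ : GenToeplitz.Linf) (hθ : GenToeplitz.IsInner θ)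
    (p : GenToeplitz.L2) (hp : GenToeplitz.IsOuter p)
    (hkp : k = GenToeplitz.mulOp θ p) :
    ∃ hg : MemLp (GenToeplitz.minimalSymbol Θ₂ θ p) ∞ (haarAddCircle (T := (1 : ℝ))),
      GenToeplitz.IsMinimalKernel E₁ E₂ k
        (GenToeplitz.toeplitzKer E₁ E₂ hg.toLp) := by
  subst hkp
  have hg := GenToeplitz.memLp_minimalSymbol hΘ₂ hθ p
  refine ⟨hg, ⟨GenToeplitz.mem_toeplitzKer.2 ⟨hk, ?_⟩, hg.toLp, rfl⟩, ?_⟩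
  · rw [hE₂_eq]
    exact GenToeplitz.mulOp_minimalSymbol_mem_orthogonal hΘ₂ hθ hp hg
  · rintro _ ⟨hkg, g, rfl⟩ f hf
    rw [GenToeplitz.mem_toeplitzKer, hE₂_eq] at hkg hf ⊢
    exact ⟨hf.1, GenToeplitz.mulOp_mem_orthogonal_of_minimalSymbol hΘ₂ hθ hp hg hkg.2 hf.2⟩
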